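/- Let $(X_1,\mathcal B_1,m_1)$ and $(X_2,\mathcal B_2,m_2)$ be $\sigma$-finite standard Borel measure spaces with $m_1\neq 0$, and let $L^2$ denote the real $L^2$-space. A positivity preserving operator $S$ on $L^2(X,m)$ extends uniquely to a map $\tilde S$ on the set $L_+(X,m)$ of classes of measurable functions $X\to[0,\infty]$ with $\tilde S f_n\nearrow\tilde S f$ whenever $f_n\nearrow f$. A *Markovian semigroup* on $L^2(X,m)$ is a strongly continuous symmetric contraction semigroup $(T_t)_{t\ge 0}$ of positivity preserving operators with $\tilde T_t 1\le 1$ for all $t\ge 0$. It is *irreducible* if every measurable set $A$ with $\tilde T_t 1_A\le 1_A$ for all $t\ge 0$ is a null set or the complement of a null set. Its *Dirichlet form* is $$D(Q)=\Big\{f\in L^2(X,m) : \lim_{t\to 0}\tfrac1t\langle f-T_tf,f\rangle\ \text{exists in }\mathbb R\Big\},\qquad Q(f,g)=\lim_{t\to 0}\tfrac1t\langle f-T_tf,g\rangle\quad (f,g\in D(Q)).$$ Let $(T^{(1)}_t)$ and $(T^{(2)}_t)$ be irreducible Markovian semigroups on $L^2(X_1,m_1)$ and $L^2(X_2,m_2)$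 with Dirichlet forms $Q_1$ and $Q_2$. Let $U\colon L^2(X_1,m_1)\to L^2(X_2,m_2)$ be an order isomorphism, i.e. a linear bijection such that $U$ and $U^{-1}$ are positivity preserving, and suppose that $U$ intertwines the semigroups, i.e. $UT^{(1)}_tf=T^{(2)}_tUf$ for all $t\ge0$ and $f\in L^2(X_1,m_1)$. Then: 1. $U$ is bounded with $\|U\|>0$, and $\frac{1}{\|U\|}U$ is unitary. 2. There are a measurable $h\colon X_2\to(0,\infty)$ (a scaling of $U$) and a measurable $\tau\colon X_2\to X_1$ with a measurable a.e. inverse (a transformation of $U$) such that $Uf=h\cdot(f\circ\tau)$ for all $f\in L^2(X_1,m_1)$; and every such pair $(h,\tau)$ satisfies $\tau_\#(h^2m_2)=\|U\|^2m_1$, where $\tau_\#$ denotes the push-forward of measures. 3. $U D(Q_1)=D(Q_2)$, and $Q_2(Uf,Ug)=\|U\|^2Q_1(f,g)$ for all $f,g\in D(Q_1)$, where both limits exist. -/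

import Mathlib

open MeasureTheory Filter Topology
open scoped ENNReal NNReal

noncomputable section

namespace IntertwiningL2

/-! ### The extension of an operator on `L²` to `[0, ∞]`-valued functions -/

section Extension

set_option linter.unusedSectionVars false

variable {X : Type*} [MeasurableSpace X] {m : Measure X} [SigmaFinite m]

/-- The `n`-th truncation `(f ∧ n) · 1_{Sₙ}` of `f : X → [0, ∞]`, where `S₀ ⊆ S₁ ⊆ …` are measurable
sets of finite measure that exhaust `X`. It is real-valued, and it increases to `f` with `n`. -/
def truncFun (m : Measure X) [SigmaFinite m] (f : X → ℝ≥0∞) (n : ℕ) : X → ℝ :=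
  (spanningSets m n).indicator fun x => (min (f x) (n : ℝ≥0∞)).toReal

theorem memLp_truncFun (f : X →ₘ[m] ℝ≥0∞) (n : ℕ) : MemLp (truncFun m f n) 2 m := by
  have hS := measurableSet_spanningSets m n
  have hmeas : Measurable (truncFun m f n) :=
    ((f.measurable.min measurable_const).ennreal_toReal).indicator hS
  refine (memLp_indicator_const 2 hS (n : ℝ)
    (Or.inr (measure_spanningSets_lt_top m n).ne)).mono hmeas.aestronglyMeasurable
    (Eventually.of_forall fun x => ?_)
  unfold truncFun
  by_cases hx : x ∈ spanningSets m n
  · have h : (min (f x) (n : ℝ≥0∞)).toReal ≤ (n : ℝ) := by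
      simpa using ENNReal.toReal_mono (ENNReal.natCast_ne_top n) (min_le_right (f x) (n : ℝ≥0∞))
    simpa [hx] using h
  · simp [hx]

/-- The `n`-th truncation as an element of `L²`. -/
def truncLp (f : X →ₘ[m] ℝ≥0∞) (n : ℕ) : Lp ℝ 2 m :=
  (memLp_truncFun f n).toLp (truncFun m f n)

/-- The extension `S̃` of a (positivity preserving) operator `S` on `L²(X, m)` to the space `L₊(X, m)`
of all equivalence classes of measurable functions `X → [0, ∞]`: it is `S̃ f = supₙ S fₙ`, where the
functions `fₙ ∈ L²` are the truncations of `f`, which increase to `f`. See `posExt_coe` and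
`posExt_iSup` for the two properties which characterize `S̃`. -/
def posExt (S : Lp ℝ 2 m →L[ℝ] Lp ℝ 2 m) (f : X →ₘ[m] ℝ≥0∞) : X →ₘ[m] ℝ≥0∞ :=
  AEEqFun.mk (fun x => ⨆ n, ENNReal.ofReal (S (truncLp f n) x))
    (AEMeasurable.iSup fun n =>
      (Lp.aestronglyMeasurable (S (truncLp f n))).aemeasurable.ennreal_ofReal).aestronglyMeasurable

/-- The class of the indicator function `1_A` in `L₊(X, m)`. -/
def indClass (m : Measure X) {A : Set X} (hA : MeasurableSet A) : X →ₘ[m] ℝ≥0∞ :=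
  AEEqFun.mk (A.indicator fun _ => 1) (measurable_const.indicator hA).aestronglyMeasurable

/-- Monotone convergence for positivity preserving operators on `L²`. -/
theorem iSup_apply_of_monotone (S : Lp ℝ 2 m →L[ℝ] Lp ℝ 2 m) (hS : ∀ f, 0 ≤ f → 0 ≤ S f)
    (v : ℕ → Lp ℝ 2 m) (w : Lp ℝ 2 m) (hv : ∀ k, 0 ≤ v k) (hmono : Monotone v)
    (hlim : ∀ᵐ x ∂m, Tendsto (fun k => v k x) atTop (𝓝 (w x))) :
    ∀ᵐ x ∂m, (⨆ k, ENNReal.ofReal (S (v k) x)) = ENNReal.ofReal (S w x) := by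
  have hSmono : ∀ f g, f ≤ g → S f ≤ S g := fun f g h => by
    have := hS (g - f) (sub_nonneg.2 h)
    rwa [map_sub, sub_nonneg] at this
  have hmono' : ∀ᵐ x ∂m, Monotone fun k => v k x := by
    have : ∀ᵐ x ∂m, ∀ k, v k x ≤ v (k + 1) x :=
      ae_all_iff.2 fun k => (Lp.coeFn_le _ _).2 (hmono k.le_succ)
    filter_upwards [this] with x hx using monotone_nat_of_le_succ hx
  have hpos : ∀ᵐ x ∂m, 0 ≤ v 0 x := (Lp.coeFn_nonneg _).2 (hv 0)
  have hle : ∀ᵐ x ∂m, ∀ k, v k x ≤ w x := by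
    filter_upwards [hmono', hlim] with x h1 h2 k using h1.ge_of_tendsto h2 k
  have hLp : Tendsto v atTop (𝓝 w) := by
    rw [Lp.tendsto_Lp_iff_tendsto_eLpNorm']
    have hw : MemLp w 2 m := Lp.memLp w
    have key : Tendsto (fun k => ∫⁻ x, ‖(v k - w : X → ℝ) x‖ₑ ^ (2 : ℝ) ∂m) atTop
        (𝓝 (∫⁻ _, 0 ∂m)) := by
      refine tendsto_lintegral_of_dominated_convergence' (fun x => ‖w x‖ₑ ^ (2 : ℝ))
        (fun k => ?_) (fun k => ?_) ?_ ?_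
      · exact (((Lp.aestronglyMeasurable (v k)).sub
          (Lp.aestronglyMeasurable w)).enorm).pow_const _
      · filter_upwards [hmono', hpos, hle] with x h1 h2 h3
        refine ENNReal.rpow_le_rpow ?_ (by norm_num)
        rw [enorm_le_iff_norm_le]
        have h4 : 0 ≤ v k x := h2.trans (h1 (Nat.zero_le k))
        have h5 := h3 k
        rw [Pi.sub_apply, Real.norm_eq_abs, Real.norm_eq_abs, abs_le, abs_of_nonneg (h4.trans h5)]
        constructor <;> linarith
      · have := lintegral_rpow_enorm_lt_top_of_eLpNorm_lt_top (by norm_num) (by norm_num) hw.2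
        simpa using this.ne
      · filter_upwards [hlim] with x hx
        have h1 : Tendsto (fun k => (v k - w : X → ℝ) x) atTop (𝓝 0) := by
          simpa using hx.sub_const (w x)
        have h2 := (ENNReal.continuous_rpow_const (y := 2)).tendsto _ |>.comp h1.enorm
        simpa [Function.comp_def] using h2
    have h3 := (ENNReal.continuous_rpow_const (y := 1 / 2)).tendsto _ |>.comp key
    simp only [lintegral_zero] at h3
    rw [ENNReal.zero_rpow_of_pos (by norm_num)] at h3
    refine h3.congr fun k => ?_
    rw [eLpNorm_eq_lintegral_rpow_enorm_toReal (by norm_num) (by norm_num)]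
    simp
  have hSLp : Tendsto (fun k => S (v k)) atTop (𝓝 (S w)) := (S.continuous.tendsto w).comp hLp
  obtain ⟨φ, -, hφ⟩ := (tendstoInMeasure_of_tendsto_Lp hSLp).exists_seq_tendsto_ae
  have hw : ∀ k, v k ≤ w := fun k => (Lp.coeFn_le _ _).1 (hle.mono fun x h => h k)
  have hSle : ∀ᵐ x ∂m, ∀ k, S (v k) x ≤ S w x :=
    ae_all_iff.2 fun k => (Lp.coeFn_le _ _).2 (hSmono _ _ (hw k))
  filter_upwards [hφ, hSle] with x h1 h2
  refine le_antisymm (iSup_le fun k => ENNReal.ofReal_le_ofReal (h2 k)) ?_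
  exact le_of_tendsto ((ENNReal.continuous_ofReal.tendsto _).comp h1)
    (Eventually.of_forall fun k => le_iSup (fun k => ENNReal.ofReal (S (v k) x)) (φ k))

theorem truncFun_mono {f g : X → ℝ≥0∞} {x : X} {n k : ℕ} (h : f x ≤ g x) (hnk : n ≤ k) :
    truncFun m f n x ≤ truncFun m g k x := by
  unfold truncFun
  have hsub := monotone_spanningSets m hnk
  by_cases hx : x ∈ spanningSets m n
  · rw [Set.indicator_of_mem hx, Set.indicator_of_mem (hsub hx)]
    exact ENNReal.toReal_mono (ne_top_of_le_ne_top (ENNReal.natCast_ne_top k) (min_le_right _ _))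
      (min_le_min h (by exact_mod_cast hnk))
  · rw [Set.indicator_of_notMem hx]
    exact Set.indicator_nonneg (fun _ _ => ENNReal.toReal_nonneg) _

theorem truncFun_nonneg (f : X → ℝ≥0∞) (n : ℕ) (x : X) : 0 ≤ truncFun m f n x :=
  Set.indicator_nonneg (fun _ _ => ENNReal.toReal_nonneg) _

theorem coeFn_truncLp (f : X →ₘ[m] ℝ≥0∞) (n : ℕ) : truncLp f n =ᵐ[m] truncFun m f n :=
  MemLp.coeFn_toLp _

theorem truncLp_nonneg (f : X →ₘ[m] ℝ≥0∞) (n : ℕ) : 0 ≤ truncLp f n := by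
  rw [← Lp.coeFn_nonneg]
  filter_upwards [coeFn_truncLp f n] with x hx
  rw [hx]
  exact truncFun_nonneg _ _ _

theorem truncLp_mono {f g : X →ₘ[m] ℝ≥0∞} {n k : ℕ} (h : f ≤ g) (hnk : n ≤ k) :
    truncLp f n ≤ truncLp g k := by
  rw [← Lp.coeFn_le]
  filter_upwards [coeFn_truncLp f n, coeFn_truncLp g k, AEEqFun.coeFn_le.2 h] with x h1 h2 h3
  rw [h1, h2]
  exact truncFun_mono h3 hnk

/-- `S̃` extends `S`: if `0 ≤ u ∈ L²`, then `S̃ u = S u`. -/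
theorem posExt_coe (S : Lp ℝ 2 m →L[ℝ] Lp ℝ 2 m) (hS : ∀ f, 0 ≤ f → 0 ≤ S f) (u : Lp ℝ 2 m)
    (hu : 0 ≤ u) (f : X →ₘ[m] ℝ≥0∞) (hf : f =ᵐ[m] fun x => ENNReal.ofReal (u x)) :
    posExt S f =ᵐ[m] fun x => ENNReal.ofReal (S u x) := by
  refine (AEEqFun.coeFn_mk _ _).trans ?_
  refine iSup_apply_of_monotone S hS (truncLp f) u (truncLp_nonneg f)
    (fun n k h => truncLp_mono le_rfl h) ?_
  have h1 : ∀ᵐ x ∂m, ∀ n, truncLp f n x = truncFun m f n x :=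
    ae_all_iff.2 fun n => coeFn_truncLp f n
  filter_upwards [h1, hf, (Lp.coeFn_nonneg u).2 hu] with x h1 h2 h3
  refine tendsto_const_nhds.congr' ?_
  obtain ⟨N, hN⟩ := exists_nat_ge (u x)
  filter_upwards [eventually_ge_atTop N, eventually_ge_atTop (spanningSetsIndex m x)] with n hn hn'
  rw [h1, truncFun, Set.indicator_of_mem (monotone_spanningSets m hn' (mem_spanningSetsIndex m x)),
    h2, min_eq_left, ENNReal.toReal_ofReal h3]
  rw [← ENNReal.ofReal_natCast]
  exact ENNReal.ofReal_le_ofReal (hN.trans (by exact_mod_cast hn))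

/-- `S̃` is continuous along increasing sequences: if `gₖ ↗ f`, then `S̃ gₖ ↗ S̃ f`. -/
theorem posExt_iSup (S : Lp ℝ 2 m →L[ℝ] Lp ℝ 2 m) (hS : ∀ f, 0 ≤ f → 0 ≤ S f)
    (g : ℕ → X →ₘ[m] ℝ≥0∞) (f : X →ₘ[m] ℝ≥0∞) (hg : Monotone g)
    (hf : f =ᵐ[m] fun x => ⨆ k, g k x) :
    posExt S f =ᵐ[m] fun x => ⨆ k, posExt S (g k) x := by
  have hgm : ∀ᵐ x ∂m, Monotone fun k => g k x := by
    have : ∀ᵐ x ∂m, ∀ k, g k x ≤ g (k + 1) x :=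
      ae_all_iff.2 fun k => AEEqFun.coeFn_le.2 (hg k.le_succ)
    filter_upwards [this] with x hx using monotone_nat_of_le_succ hx
  have h1 : ∀ᵐ x ∂m, ∀ n,
      (⨆ k, ENNReal.ofReal (S (truncLp (g k) n) x)) = ENNReal.ofReal (S (truncLp f n) x) := by
    refine ae_all_iff.2 fun n => ?_
    refine iSup_apply_of_monotone S hS (fun k => truncLp (g k) n) _
      (fun k => truncLp_nonneg _ n) (fun i j h => truncLp_mono (hg h) le_rfl) ?_
    have h2 : ∀ᵐ x ∂m, ∀ k, truncLp (g k) n x = truncFun m (g k) n x :=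
      ae_all_iff.2 fun k => coeFn_truncLp _ n
    filter_upwards [h2, coeFn_truncLp f n, hf, hgm] with x h2 h3 h4 h5
    simp only [h2, h3]
    unfold truncFun
    by_cases hx : x ∈ spanningSets m n
    · simp only [Set.indicator_of_mem hx]
      have h6 : Tendsto (fun k => min (g k x) (n : ℝ≥0∞)) atTop (𝓝 (min (f x) n)) := by
        rw [h4]
        exact (tendsto_atTop_iSup h5).min tendsto_const_nhds
      exact (ENNReal.tendsto_toReal
        (ne_top_of_le_ne_top (ENNReal.natCast_ne_top n) (min_le_right _ _))).comp h6
    · simp only [Set.indicator_of_notMem hx]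
      exact tendsto_const_nhds
  have h2 : ∀ᵐ x ∂m, ∀ k, posExt S (g k) x = ⨆ n, ENNReal.ofReal (S (truncLp (g k) n) x) :=
    ae_all_iff.2 fun k => AEEqFun.coeFn_mk _ _
  have h3 : ∀ᵐ x ∂m, posExt S f x = ⨆ n, ENNReal.ofReal (S (truncLp f n) x) :=
    AEEqFun.coeFn_mk _ _
  filter_upwards [h1, h2, h3] with x h1 h2 h3
  simp only [h2, h3, ← h1]
  exact iSup_comm

end Extension

/-! ### Markovian semigroups -/

section Semigroup

variable {X : Type*} [MeasurableSpace X] {m : Measure X} [SigmaFinite m]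

/-- A Markovian semigroup: a strongly continuous symmetric contraction semigroup `(T_t)_{t ≥ 0}` of
positivity preserving operators on real `L²(X, m)` such that `T̃_t 1 ≤ 1` for all `t ≥ 0`. -/
structure IsMarkovianSemigroup (T : ℝ≥0 → Lp ℝ 2 m →L[ℝ] Lp ℝ 2 m) : Prop where
  zero_apply : ∀ f, T 0 f = f
  add_apply : ∀ s t f, T (s + t) f = T s (T t f)
  tendsto_zero : ∀ f, Tendsto (fun t => T t f) (𝓝 0) (𝓝 f)
  symmetric : ∀ t f g, inner ℝ (T t f) g = inner ℝ f (T t g)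
  contraction : ∀ t f, ‖T t f‖ ≤ ‖f‖
  nonneg : ∀ t f, 0 ≤ f → 0 ≤ T t f
  posExt_one_le : ∀ t, posExt (T t) 1 ≤ 1

/-- The measurable set `A` is invariant under `(T_t)`: `T̃_t 1_A ≤ 1_A` for all `t ≥ 0`. -/
def IsInvariantSet (T : ℝ≥0 → Lp ℝ 2 m →L[ℝ] Lp ℝ 2 m) {A : Set X} (hA : MeasurableSet A) : Prop :=
  ∀ t, posExt (T t) (indClass m hA) ≤ indClass m hA

/-- `(T_t)` is irreducible: every invariant set is a null set or the complement of a null set. -/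
def IsIrreducibleSemigroup (T : ℝ≥0 → Lp ℝ 2 m →L[ℝ] Lp ℝ 2 m) : Prop :=
  ∀ (A : Set X) (hA : MeasurableSet A), IsInvariantSet T hA → m A = 0 ∨ m Aᶜ = 0

/-- `q` is the value `Q(f, g) = lim_{t → 0} (1/t) ⟨f - T_t f, g⟩`, i.e. the limit exists and is `q`. -/
def HasFormValue (T : ℝ≥0 → Lp ℝ 2 m →L[ℝ] Lp ℝ 2 m) (f g : Lp ℝ 2 m) (q : ℝ) : Prop :=
  Tendsto (fun t : ℝ≥0 => (1 / (t : ℝ)) * inner ℝ (f - T t f) g) (𝓝[>] 0) (𝓝 q)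

/-- The domain `D(Q)` of the Dirichlet form of `(T_t)`: the set of all `f ∈ L²` for which the limit
`lim_{t → 0} (1/t) ⟨f - T_t f, f⟩` exists in `ℝ`. -/
def formDomain (T : ℝ≥0 → Lp ℝ 2 m →L[ℝ] Lp ℝ 2 m) : Set (Lp ℝ 2 m) :=
  {f | ∃ q : ℝ, HasFormValue T f f q}

end Semigroup

/-! ### Order isomorphisms -/

section OrderIso

variable {X₁ X₂ : Type*} [MeasurableSpace X₁] [MeasurableSpace X₂]
  {m₁ : Measure X₁} {m₂ : Measure X₂}

/-- An order isomorphism: an invertible linear map (not assumed to be continuous) which preserves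
positivity, as does its inverse. -/
structure IsOrderIsomorphism (U : Lp ℝ 2 m₁ ≃ₗ[ℝ] Lp ℝ 2 m₂) : Prop where
  nonneg : ∀ f, 0 ≤ f → 0 ≤ U f
  symm_nonneg : ∀ g, 0 ≤ g → 0 ≤ U.symm g

/-- `U` intertwines the semigroups: `U T_t⁽¹⁾ f = T_t⁽²⁾ U f` for all `t ≥ 0` and all `f ∈ L²`. -/
def Intertwines (U : Lp ℝ 2 m₁ ≃ₗ[ℝ] Lp ℝ 2 m₂) (T₁ : ℝ≥0 → Lp ℝ 2 m₁ →L[ℝ] Lp ℝ 2 m₁)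
    (T₂ : ℝ≥0 → Lp ℝ 2 m₂ →L[ℝ] Lp ℝ 2 m₂) : Prop :=
  ∀ t f, U (T₁ t f) = T₂ t (U f)

/-- `h : X₂ → (0, ∞)` and `τ : X₂ → X₁` are the scaling and the transformation associated with `U`:
both are measurable, `τ` has a measurable a.e. inverse, and `U f = h · (f ∘ τ)` a.e. for every
square-integrable `f : X₁ → ℝ`, i.e. for every representative of every element of `L²`. -/
structure IsScalingTransformation (U : Lp ℝ 2 m₁ ≃ₗ[ℝ] Lp ℝ 2 m₂) (h : X₂ → ℝ) (τ : X₂ → X₁) :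
    Prop where
  measurable_scaling : Measurable h
  scaling_pos : ∀ y, 0 < h y
  measurable_transformation : Measurable τ
  exists_ae_inverse : ∃ σ : X₁ → X₂, Measurable σ ∧ (∀ᵐ y ∂m₂, σ (τ y) = y) ∧
    ∀ᵐ x ∂m₁, τ (σ x) = x
  apply_ae_eq : ∀ (f : X₁ → ℝ) (hf : MemLp f 2 m₁), U (hf.toLp f) =ᵐ[m₂] fun y => h y * f (τ y)

end OrderIso

end IntertwiningL2

end

open IntertwiningL2

/-!
An order isomorphism `U` is automatically bounded (`exists_norm_map_le_of_map_nonneg`), and, being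
an isomorphism of vector lattices, it preserves disjointness and inclusion of supports.

*Weighted composition.* Fix `w > 0` in `L²(m₁)` and a bounded measurable embedding `e : X₁ → ℝ`, and
let `r = U(e w) / U w`. Since `U` is a lattice homomorphism, `U((e w - a w)⁺) = (U(e w) - a U w)⁺`,
and comparing supports gives `U(1_{e > a} w) = 1_{r > a} U w` for every `a` (`map_indLp_lt`). Pairing
with `g ≥ 0` in `L²(m₂)`, the finite measures `e_#(w (U* g) m₁)` and `r_#((U w) g m₂)` agree on
half-lines, hence everywhere. So `τ = e⁻¹ ∘ r` transports `(U w) g m₂` to `w (U* g) m₁`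
(`exists_map_withDensity_eq`), which is `U f = h · (f ∘ τ)` with `h = U w / (w ∘ τ)`, tested against
`g` (`exists_apply_ae_eq`). The transformation of `U⁻¹` is an a.e. inverse of `τ`.

*Unitarity.* Because `U` is a weighted composition operator, `U* U` is a multiplication operator
(`adjoint_apply_mul_ae_eq`). By symmetry of the semigroups it commutes with `T⁽¹⁾`. The sublevel sets
of its multiplier are then invariant, so irreducibility makes the multiplier a constant `c`
(`exists_eq_smul_of_commute`). Thus `⟨U f, U g⟩ = c ⟨f, g⟩` and `c = ‖U‖²`. Applied to indicators, this
is the transport formula `τ_#(h² m₂) = c m₁`.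

*Forms.* The identity `⟨U f - T⁽²⁾_t U f, U g⟩ = c ⟨f - T⁽¹⁾_t f, g⟩` transfers limits. That the limit
`Q₁(f, g)` exists for all `f, g ∈ D(Q₁)` needs `D(Q₁)` to be closed under addition: as
`t ↦ ⟨T_t f, f⟩` is convex, `(1/t) ⟨f - T_t f, f⟩` is antitone in `t` (`antitoneOn_approxForm`), so that
membership in `D(Q₁)` is boundedness, and the parallelogram law and polarization apply.
-/

namespace IntertwiningL2

/-! ### Order isomorphisms between `L²`-spaces -/

section OrderIsomorphism

variable {X₁ X₂ : Type*} [MeasurableSpace X₁] [MeasurableSpace X₂]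
  {m₁ : Measure X₁} {m₂ : Measure X₂}

theorem monotone_of_map_nonneg (U : Lp ℝ 2 m₁ →ₗ[ℝ] Lp ℝ 2 m₂) (hU : ∀ f, 0 ≤ f → 0 ≤ U f) :
    Monotone U := fun f g h => by
  have := hU (g - f) (sub_nonneg.2 h)
  rwa [map_sub, sub_nonneg] at this

/-- Positive operators are bounded: otherwise there would be `fₙ ≥ 0` with `‖fₙ‖ ≤ 2⁻ⁿ` and
`‖U fₙ‖ > n`, and `‖U (∑ fₙ)‖` would be larger than every `n`. -/
theorem exists_norm_map_le_of_map_nonneg (U : Lp ℝ 2 m₁ →ₗ[ℝ] Lp ℝ 2 m₂)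
    (hU : ∀ f, 0 ≤ f → 0 ≤ U f) : ∃ C : ℝ, ∀ f, ‖U f‖ ≤ C * ‖f‖ := by
  have hmono := monotone_of_map_nonneg U hU
  by_contra! hcon
  have hstep : ∀ n : ℕ, ∃ f : Lp ℝ 2 m₁, 0 ≤ f ∧ ‖f‖ ≤ (1 / 2) ^ n ∧ (n : ℝ) < ‖U f‖ := by
    intro n
    obtain ⟨f, hf⟩ := hcon (n * 2 ^ n)
    have hf0 : 0 < ‖f‖ := by
      rcases (norm_nonneg f).eq_or_lt with h | h
      · have : f = 0 := norm_eq_zero.1 h.symm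
        simp [this] at hf
      · exact h
    set c : ℝ := (1 / 2) ^ n / ‖f‖
    have hc : 0 < c := by positivity
    refine ⟨|c • f|, abs_nonneg _, ?_, ?_⟩
    · rw [norm_abs_eq_norm, norm_smul, Real.norm_of_nonneg hc.le, div_mul_cancel₀ _ hf0.ne']
    · have hcf : ‖U (c • f)‖ ≤ ‖U |c • f|‖ := by
        refine norm_le_norm_of_abs_le_abs ?_
        rw [abs_of_nonneg (hU _ (abs_nonneg _))]
        refine sup_le (hmono (le_abs_self _)) ?_
        rw [← map_neg]
        exact hmono (neg_le_abs _)
      refine lt_of_lt_of_le ?_ hcf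
      rw [map_smul, norm_smul, Real.norm_of_nonneg hc.le]
      calc (n : ℝ) = c * (n * 2 ^ n * ‖f‖) := by
            simp only [c]; field_simp; rw [mul_assoc, ← mul_pow]; norm_num
        _ < c * ‖U f‖ := by gcongr
  choose f hf0 hfn hfU using hstep
  have hsum : Summable f := Summable.of_norm_bounded
    (summable_geometric_of_lt_one (by norm_num) (by norm_num)) hfn
  obtain ⟨n, hn⟩ := exists_nat_gt ‖U (∑' k, f k)‖
  have hle : U (f n) ≤ U (∑' k, f k) := hmono (hsum.le_tsum n fun k _ => hf0 k)
  have := norm_le_norm_of_abs_le_abs (a := U (f n)) (b := U (∑' k, f k)) (by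
    rwa [abs_of_nonneg (hU _ (hf0 n)), abs_of_nonneg (hU _ (tsum_nonneg hf0))])
  linarith [hfU n]

namespace IsOrderIsomorphism

variable {U : Lp ℝ 2 m₁ ≃ₗ[ℝ] Lp ℝ 2 m₂}

theorem symm (hU : IsOrderIsomorphism U) : IsOrderIsomorphism U.symm :=
  ⟨hU.symm_nonneg, by simpa using hU.nonneg⟩

/-- `U` as an isomorphism of partially ordered sets. -/
def orderIso (hU : IsOrderIsomorphism U) : Lp ℝ 2 m₁ ≃o Lp ℝ 2 m₂ where
  toEquiv := U.toEquiv
  map_rel_iff' {f g} := by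
    refine ⟨fun h => ?_, fun h => monotone_of_map_nonneg U.toLinearMap hU.nonneg h⟩
    simpa using monotone_of_map_nonneg U.symm.toLinearMap hU.symm_nonneg h

theorem map_sup (hU : IsOrderIsomorphism U) (f g : Lp ℝ 2 m₁) : U (f ⊔ g) = U f ⊔ U g :=
  OrderIso.map_sup hU.orderIso f g

theorem map_inf (hU : IsOrderIsomorphism U) (f g : Lp ℝ 2 m₁) : U (f ⊓ g) = U f ⊓ U g :=
  OrderIso.map_inf hU.orderIso f g

theorem map_abs (hU : IsOrderIsomorphism U) (f : Lp ℝ 2 m₁) : U |f| = |U f| := by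
  simp only [abs, hU.map_sup, map_neg]

end IsOrderIsomorphism

theorem abs_inf_abs_eq_zero_iff (f g : Lp ℝ 2 m₁) :
    |f| ⊓ |g| = 0 ↔ ∀ᵐ x ∂m₁, f x = 0 ∨ g x = 0 := by
  have key : ∀ᵐ x ∂m₁, (|f| ⊓ |g| : Lp ℝ 2 m₁) x = min |f x| |g x| := by
    filter_upwards [Lp.coeFn_inf |f| |g|, Lp.coeFn_abs f, Lp.coeFn_abs g] with x h1 h2 h3
    rw [h1, Pi.inf_apply, h2, h3]
  rw [Lp.eq_zero_iff_ae_eq_zero]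
  constructor
  · intro h
    filter_upwards [key, h] with x h1 h2
    rw [h1, Pi.zero_apply] at h2
    rcases min_choice |f x| |g x| with h3 | h3 <;> rw [h3] at h2
    · exact Or.inl (abs_eq_zero.1 h2)
    · exact Or.inr (abs_eq_zero.1 h2)
  · intro h
    filter_upwards [key, h] with x h1 h2
    rw [h1, Pi.zero_apply]
    rcases h2 with h2 | h2 <;> simp [h2]

/-- The indicator `1_A f` of an element `f` of `L²`. -/
noncomputable def indLp {A : Set X₁} (hA : MeasurableSet A) (f : Lp ℝ 2 m₁) : Lp ℝ 2 m₁ :=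
  ((Lp.memLp f).indicator hA).toLp (A.indicator f)

theorem coeFn_indLp {A : Set X₁} (hA : MeasurableSet A) (f : Lp ℝ 2 m₁) :
    indLp hA f =ᵐ[m₁] A.indicator f :=
  MemLp.coeFn_toLp _

theorem indLp_add_indLp_compl {A : Set X₁} (hA : MeasurableSet A) (f : Lp ℝ 2 m₁) :
    indLp hA f + indLp hA.compl f = f := by
  refine Lp.ext ?_
  filter_upwards [Lp.coeFn_add (indLp hA f) (indLp hA.compl f), coeFn_indLp hA f,
    coeFn_indLp hA.compl f] with x h1 h2 h3
  rw [h1, Pi.add_apply, h2, h3]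
  exact Set.indicator_self_add_compl_apply A f x

namespace IsOrderIsomorphism

variable {U : Lp ℝ 2 m₁ ≃ₗ[ℝ] Lp ℝ 2 m₂}

theorem map_disjoint (hU : IsOrderIsomorphism U) {f g : Lp ℝ 2 m₁}
    (h : ∀ᵐ x ∂m₁, f x = 0 ∨ g x = 0) : ∀ᵐ y ∂m₂, U f y = 0 ∨ U g y = 0 := by
  rw [← abs_inf_abs_eq_zero_iff] at h ⊢
  rw [← hU.map_abs, ← hU.map_abs, ← hU.map_inf, h, map_zero]

/-- An order isomorphism preserves inclusions of supports, since the support of `f` is contained in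
that of `g` iff `f` is disjoint from everything that `g` is disjoint from. -/
theorem map_support_subset (hU : IsOrderIsomorphism U) {f g : Lp ℝ 2 m₁}
    (h : ∀ᵐ x ∂m₁, g x = 0 → f x = 0) : ∀ᵐ y ∂m₂, U g y = 0 → U f y = 0 := by
  have hA : MeasurableSet {y | U g y = 0} :=
    (Lp.stronglyMeasurable (U g)).measurable (measurableSet_singleton 0)
  set k := indLp hA (U f)
  have h1 : ∀ᵐ y ∂m₂, k y = 0 ∨ U g y = 0 := by
    filter_upwards [coeFn_indLp hA (U f)] with y hy
    by_cases hyA : y ∈ {y | U g y = 0}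
    · exact Or.inr hyA
    · left; rw [hy, Set.indicator_of_notMem hyA]
  have h2 : ∀ᵐ x ∂m₁, U.symm k x = 0 ∨ f x = 0 := by
    have := hU.symm.map_disjoint h1
    rw [U.symm_apply_apply] at this
    filter_upwards [this, h] with x h3 h4 using h3.imp_right h4
  have h3 := hU.map_disjoint h2
  rw [U.apply_symm_apply] at h3
  filter_upwards [h3, coeFn_indLp hA (U f)] with y h4 h5 h6
  rw [h5, Set.indicator_of_mem (s := {y | U g y = 0}) h6, or_self] at h4
  exact h4

end IsOrderIsomorphism

end OrderIsomorphism

/-! ### Representation of order isomorphisms by scalings and transformations -/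

section Representation

variable {X : Type*} [MeasurableSpace X] {m : Measure X}

theorem exists_pos_memLp_two (m : Measure X) [SigmaFinite m] :
    ∃ w : X → ℝ, Measurable w ∧ (∀ x, 0 < w x) ∧ MemLp w 2 m := by
  obtain ⟨g, hg0, hgm, hg⟩ := exists_pos_lintegral_lt_of_sigmaFinite m one_ne_zero
  have hwm : Measurable fun x => Real.sqrt (g x) := by fun_prop
  refine ⟨fun x => Real.sqrt (g x), hwm, fun x => Real.sqrt_pos.2 (hg0 x), ?_⟩
  rw [memLp_two_iff_integrable_sq hwm.aestronglyMeasurable]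
  simp only [Real.sq_sqrt (NNReal.coe_nonneg _)]
  refine ⟨by fun_prop, ?_⟩
  rw [hasFiniteIntegral_iff_enorm]
  simpa using hg.trans ENNReal.one_lt_top

theorem exists_measurableEmbedding_real_bounded (X : Type*) [MeasurableSpace X]
    [StandardBorelSpace X] : ∃ e : X → ℝ, MeasurableEmbedding e ∧ ∀ x, ‖e x‖ ≤ 2 := by
  obtain ⟨e, he⟩ := exists_measurableEmbedding_real X
  refine ⟨fun x => Real.arctan (e x), ?_, fun x => ?_⟩
  · exact (Real.measurable_arctan.comp he.measurable).measurableEmbedding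
      (Real.arctan_injective.comp he.injective)
  · rw [Real.norm_eq_abs, abs_le]
    have h1 := Real.neg_pi_div_two_lt_arctan (e x)
    have h2 := Real.arctan_lt_pi_div_two (e x)
    have h3 := Real.pi_le_four
    constructor <;> linarith

theorem measurable_ofReal_mul_Lp (f g : Lp ℝ 2 m) :
    Measurable fun x => ENNReal.ofReal (f x * g x) :=
  ((Lp.stronglyMeasurable f).measurable.mul (Lp.stronglyMeasurable g).measurable).ennreal_ofReal

theorem integrable_mul_Lp (f g : Lp ℝ 2 m) : Integrable (fun x => f x * g x) m :=
  (Lp.memLp f).integrable_mul (Lp.memLp g)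

theorem inner_eq_integral_mul (f g : Lp ℝ 2 m) : inner ℝ f g = ∫ x, f x * g x ∂m := by
  rw [L2.inner_def]
  refine integral_congr_ae (Eventually.of_forall fun x => ?_)
  simp [mul_comm]

theorem inner_indLp_left {A : Set X} (hA : MeasurableSet A) (f g : Lp ℝ 2 m) :
    inner ℝ (indLp hA f) g = ∫ x in A, f x * g x ∂m := by
  rw [inner_eq_integral_mul, ← integral_indicator hA]
  refine integral_congr_ae ?_
  filter_upwards [coeFn_indLp hA f] with x hx
  rw [hx, Set.indicator_mul_left]

theorem setLIntegral_ofReal_mul {A : Set X} (hA : MeasurableSet A) {f g : Lp ℝ 2 m} (hf : 0 ≤ f)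
    (hg : 0 ≤ g) :
    ∫⁻ x in A, ENNReal.ofReal (f x * g x) ∂m = ENNReal.ofReal (inner ℝ (indLp hA f) g) := by
  rw [inner_indLp_left, ofReal_integral_eq_lintegral_ofReal (integrable_mul_Lp f g).integrableOn]
  refine ae_restrict_of_ae ?_
  filter_upwards [(Lp.coeFn_nonneg f).2 hf, (Lp.coeFn_nonneg g).2 hg] with x h1 h2
  exact mul_nonneg h1 h2

theorem lintegral_ofReal_mul {f g : Lp ℝ 2 m} (hf : 0 ≤ f) (hg : 0 ≤ g) :
    ∫⁻ x, ENNReal.ofReal (f x * g x) ∂m = ENNReal.ofReal (inner ℝ f g) := by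
  rw [inner_eq_integral_mul, ofReal_integral_eq_lintegral_ofReal (integrable_mul_Lp f g)]
  filter_upwards [(Lp.coeFn_nonneg f).2 hf, (Lp.coeFn_nonneg g).2 hg] with x h1 h2
  exact mul_nonneg h1 h2

theorem ofReal_norm_sq_eq_lintegral (f : Lp ℝ 2 m) :
    ENNReal.ofReal (‖f‖ ^ 2) = ∫⁻ x, ENNReal.ofReal (f x ^ 2) ∂m := by
  simp_rw [← real_inner_self_eq_norm_sq, inner_eq_integral_mul, pow_two]
  exact ofReal_integral_eq_lintegral_ofReal (integrable_mul_Lp f f)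
    (Eventually.of_forall fun x => mul_self_nonneg _)

theorem inner_nonneg_of_nonneg {f g : Lp ℝ 2 m} (hf : 0 ≤ f) (hg : 0 ≤ g) :
    0 ≤ (inner ℝ f g : ℝ) := by
  rw [inner_eq_integral_mul]
  refine integral_nonneg_of_ae ?_
  filter_upwards [(Lp.coeFn_nonneg f).2 hf, (Lp.coeFn_nonneg g).2 hg] with x h1 h2
  exact mul_nonneg h1 h2

theorem nonneg_of_forall_inner_nonneg {f : Lp ℝ 2 m}
    (h : ∀ g : Lp ℝ 2 m, 0 ≤ g → 0 ≤ (inner ℝ f g : ℝ)) : 0 ≤ f := by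
  have h1 := h (-f ⊔ 0) le_sup_right
  -- `⟨f, f⁻⟩ = -‖f⁻‖²`
  have h2 : (inner ℝ f (-f ⊔ 0) : ℝ) = -inner ℝ (-f ⊔ 0) (-f ⊔ 0) := by
    rw [inner_eq_integral_mul, inner_eq_integral_mul, ← integral_neg]
    refine integral_congr_ae ?_
    filter_upwards [Lp.coeFn_sup (-f) 0, Lp.coeFn_neg f, Lp.coeFn_zero ℝ 2 m] with x h3 h4 h5
    rw [h3, Pi.sup_apply, h4, h5, Pi.neg_apply, Pi.zero_apply]
    rcases le_total (f x) 0 with h6 | h6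
    · rw [sup_eq_left.2 (by linarith)]; ring
    · rw [sup_eq_right.2 (by linarith)]; ring
  rw [h2, real_inner_self_eq_norm_sq] at h1
  have h3 : ‖(-f ⊔ 0 : Lp ℝ 2 m)‖ = 0 := by nlinarith [sq_nonneg ‖(-f ⊔ 0 : Lp ℝ 2 m)‖]
  have h4 : -f ≤ 0 := sup_eq_right.1 (norm_eq_zero.1 h3)
  exact neg_nonpos.1 h4

variable {X₁ X₂ : Type*} [MeasurableSpace X₁] [MeasurableSpace X₂]
  {m₁ : Measure X₁} {m₂ : Measure X₂}

namespace IsOrderIsomorphism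

variable {U : Lp ℝ 2 m₁ ≃ₗ[ℝ] Lp ℝ 2 m₂}

theorem map_pos [SigmaFinite m₂] (hU : IsOrderIsomorphism U) {f : Lp ℝ 2 m₁}
    (hf : ∀ᵐ x ∂m₁, 0 < f x) : ∀ᵐ y ∂m₂, 0 < U f y := by
  obtain ⟨w, -, hw0, hw⟩ := exists_pos_memLp_two m₂
  have h1 := hU.map_support_subset (f := U.symm (hw.toLp w)) (g := f)
    (by filter_upwards [hf] with x hx h0 using absurd h0 hx.ne')
  rw [U.apply_symm_apply] at h1
  have h2 : 0 ≤ U f := hU.nonneg f <| (Lp.coeFn_nonneg f).1 <| hf.mono fun x hx => hx.le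
  filter_upwards [h1, hw.coeFn_toLp, (Lp.coeFn_nonneg _).2 h2] with y h3 h4 h5
  refine lt_of_le_of_ne h5 fun h => ?_
  have := h3 h.symm
  rw [h4] at this
  exact (hw0 y).ne' this

/-- An order isomorphism acts on superlevel sets: if `e` is bounded and `r = U(e w) / U w`, then
`U(1_{e > a} w) = 1_{r > a} U w`. Indeed `1_{e > a} w` has the same support as
`(e w - a w)⁺`, hence its image has the same support as `(U(e w) - a U w)⁺`. -/
theorem map_indLp_lt [SigmaFinite m₂] (hU : IsOrderIsomorphism U) {e : X₁ → ℝ} {W E : Lp ℝ 2 m₁}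
    (hW : ∀ᵐ x ∂m₁, 0 < W x) (hE : ∀ᵐ x ∂m₁, E x = e x * W x) (a : ℝ)
    (hB : MeasurableSet {x | a < e x}) :
    ∀ᵐ y ∂m₂, U (indLp hB W) y = {y | a < U E y / U W y}.indicator (U W) y := by
  set P : Lp ℝ 2 m₁ := (E - a • W) ⊔ 0
  have hP : ∀ᵐ x ∂m₁, P x = max ((e x - a) * W x) 0 := by
    filter_upwards [hE, Lp.coeFn_sup (E - a • W) 0, Lp.coeFn_sub E (a • W), Lp.coeFn_smul a W,
      Lp.coeFn_zero ℝ 2 m₁] with x h1 h2 h3 h4 h5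
    rw [h2, Pi.sup_apply, h3, Pi.sub_apply, h4, h5, Pi.smul_apply, h1, smul_eq_mul, sub_mul]
    rfl
  have hUP : ∀ᵐ y ∂m₂, U P y = max (U E y - a * U W y) 0 := by
    have h0 : U P = (U E - a • U W) ⊔ 0 := by
      simp only [P]; rw [hU.map_sup, map_sub, map_smul, map_zero]
    rw [h0]
    filter_upwards [Lp.coeFn_sup (U E - a • U W) 0, Lp.coeFn_sub (U E) (a • U W),
      Lp.coeFn_smul a (U W), Lp.coeFn_zero ℝ 2 m₂] with x h2 h3 h4 h5
    rw [h2, Pi.sup_apply, h3, Pi.sub_apply, h4, h5, Pi.smul_apply, smul_eq_mul]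
    rfl
  have hsupp : ∀ᵐ x ∂m₁, P x = 0 ↔ indLp hB W x = 0 := by
    filter_upwards [hP, hW, coeFn_indLp hB W] with x h1 h2 h3
    rw [h1, h3, max_eq_right_iff, Set.indicator_apply_eq_zero, Set.mem_ofPred_eq]
    constructor
    · intro h4 h5
      exact absurd h4 (not_le.2 (mul_pos (sub_pos.2 h5) h2))
    · intro h4
      have h5 : e x ≤ a := not_lt.1 fun h => h2.ne' (h4 h)
      exact mul_nonpos_of_nonpos_of_nonneg (sub_nonpos.2 h5) h2.le
  have hs1 := hU.map_support_subset (hsupp.mono fun x h => h.1)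
  have hs2 := hU.map_support_subset (hsupp.mono fun x h => h.2)
  have hdisj : ∀ᵐ y ∂m₂, U (indLp hB W) y = 0 ∨ U (indLp hB.compl W) y = 0 := by
    refine hU.map_disjoint ?_
    filter_upwards [coeFn_indLp hB W, coeFn_indLp hB.compl W] with x h1 h2
    rw [h1, h2]
    by_cases hx : x ∈ {x | a < e x}
    · right; simp [Set.indicator_of_notMem (s := {x | a < e x}ᶜ) (not_not.2 hx)]
    · left; rw [Set.indicator_of_notMem hx]
  have hsum : ∀ᵐ y ∂m₂, U (indLp hB W) y + U (indLp hB.compl W) y = U W y := by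
    have h1 := Lp.coeFn_add (U (indLp hB W)) (U (indLp hB.compl W))
    rw [← map_add, indLp_add_indLp_compl] at h1
    exact h1.mono fun y h => h.symm
  filter_upwards [hUP, hs1, hs2, hdisj, hsum, hU.map_pos hW] with y h1 h2 h3 h4 h5 h6
  by_cases hy : a < U E y / U W y
  · rw [Set.indicator_of_mem (s := {y | a < U E y / U W y}) hy]
    rw [lt_div_iff₀ h6] at hy
    rcases h4 with h4 | h4
    · have := h3 h4
      rw [h1, max_eq_right_iff] at this
      linarith
    · linarith
  · rw [Set.indicator_of_notMem (s := {y | a < U E y / U W y}) hy]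
    rw [not_lt, div_le_iff₀ h6] at hy
    apply h2
    rw [h1, max_eq_right_iff]
    linarith

/-- There is a measurable `τ : X₂ → X₁` which transports the measure `(U w) g m₂` to `w (U* g) m₁`
for every `0 ≤ g ∈ L²(m₂)`, where `w > 0` is a fixed element of `L²(m₁)`. If `e` is a bounded
measurable embedding of `X₁` into `ℝ` and `r = U(e w) / U w`, then `τ = e⁻¹ ∘ r`. -/
theorem exists_map_withDensity_eq [StandardBorelSpace X₁] [Nonempty X₁] [SigmaFinite m₂]
    (hU : IsOrderIsomorphism U) (V : Lp ℝ 2 m₁ →L[ℝ] Lp ℝ 2 m₂) (hV : ∀ f, V f = U f)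
    {W : Lp ℝ 2 m₁} (hW : ∀ᵐ x ∂m₁, 0 < W x) :
    ∃ τ : X₂ → X₁, Measurable τ ∧ ∀ g : Lp ℝ 2 m₂, 0 ≤ g →
      (m₂.withDensity fun y => ENNReal.ofReal (U W y * g y)).map τ =
        m₁.withDensity fun x => ENNReal.ofReal (W x * V.adjoint g x) := by
  obtain ⟨e, he, he2⟩ := exists_measurableEmbedding_real_bounded X₁
  have hmem : MemLp (fun x => e x * W x) 2 m₁ :=
    (Lp.memLp W).of_le_mul (c := 2)
      (he.measurable.aestronglyMeasurable.mul (Lp.aestronglyMeasurable W))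
      (Eventually.of_forall fun x => by
        rw [norm_mul]; exact mul_le_mul_of_nonneg_right (he2 x) (norm_nonneg _))
  set E : Lp ℝ 2 m₁ := hmem.toLp _
  have hE : ∀ᵐ x ∂m₁, E x = e x * W x := hmem.coeFn_toLp
  have hW0 : 0 ≤ W := (Lp.coeFn_nonneg W).1 <| hW.mono fun x hx => hx.le
  set r : X₂ → ℝ := fun y => U E y / U W y
  have hr : Measurable r :=
    (Lp.stronglyMeasurable (U E)).measurable.div (Lp.stronglyMeasurable (U W)).measurable
  obtain ⟨l, hl, hle⟩ := he.exists_measurable_extend measurable_id fun _ => inferInstance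
  refine ⟨l ∘ r, hl.comp hr, fun g hg => ?_⟩
  have hadj : 0 ≤ V.adjoint g := nonneg_of_forall_inner_nonneg fun f hf => by
    rw [V.adjoint_inner_left, hV]
    exact inner_nonneg_of_nonneg hg (hU.nonneg f hf)
  have key : (m₁.withDensity fun x => ENNReal.ofReal (W x * V.adjoint g x)).map e =
      (m₂.withDensity fun y => ENNReal.ofReal (U W y * g y)).map r := by
    have hfin : IsFiniteMeasure (m₁.withDensity fun x => ENNReal.ofReal (W x * V.adjoint g x)) := by
      refine isFiniteMeasure_withDensity ?_
      rw [lintegral_ofReal_mul hW0 hadj]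
      exact ENNReal.ofReal_ne_top
    refine Measure.ext_of_Iic _ _ fun a => ?_
    have hea : MeasurableSet (e ⁻¹' Set.Iic a) := he.measurable measurableSet_Iic
    have hra : MeasurableSet (r ⁻¹' Set.Iic a) := hr measurableSet_Iic
    rw [Measure.map_apply he.measurable measurableSet_Iic, Measure.map_apply hr measurableSet_Iic,
      withDensity_apply _ hea, withDensity_apply _ hra,
      setLIntegral_ofReal_mul hea hW0 hadj, setLIntegral_ofReal_mul hra (hU.nonneg W hW0) hg,
      V.adjoint_inner_right, hV]
    congr 2
    have hB : MeasurableSet {x | a < e x} := he.measurable measurableSet_Ioi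
    have hind := hU.map_indLp_lt hW hE a hB
    have h1 : indLp hea W = W - indLp hB W := by
      have : e ⁻¹' Set.Iic a = {x | a < e x}ᶜ := by ext x; simp
      refine eq_sub_of_add_eq' ?_
      simp only [this]
      exact indLp_add_indLp_compl hB W
    rw [h1, map_sub]
    refine Lp.ext ?_
    filter_upwards [hind, Lp.coeFn_sub (U W) (U (indLp hB W)),
      coeFn_indLp hra (U W)] with y h2 h3 h4
    rw [h3, h4, Pi.sub_apply, h2]
    by_cases hy : a < r y
    · rw [Set.indicator_of_mem (s := {y | a < U E y / U W y}) hy,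
        Set.indicator_of_notMem (s := r ⁻¹' Set.Iic a) (not_le.2 hy), sub_self]
    · rw [Set.indicator_of_notMem (s := {y | a < U E y / U W y}) hy,
        Set.indicator_of_mem (s := r ⁻¹' Set.Iic a) (not_lt.1 hy), sub_zero]
  rw [← Measure.map_map hl hr, ← key, Measure.map_map hl he.measurable, hle, Measure.map_id]

/-- `U` as a bounded operator. -/
theorem exists_continuousLinearMap (hU : IsOrderIsomorphism U) :
    ∃ V : Lp ℝ 2 m₁ →L[ℝ] Lp ℝ 2 m₂, ∀ f, V f = U f := by
  obtain ⟨C, hC⟩ := exists_norm_map_le_of_map_nonneg U.toLinearMap hU.nonneg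
  exact ⟨U.toLinearMap.mkContinuous C hC, fun f => rfl⟩

/-- Every order isomorphism is a weighted composition operator `U f = h · (f ∘ τ)`. The scaling is
`h = U w / (w ∘ τ)` for a fixed `w > 0`. -/
theorem exists_apply_ae_eq [StandardBorelSpace X₁] [Nonempty X₁] [SigmaFinite m₁] [SigmaFinite m₂]
    (hU : IsOrderIsomorphism U) :
    ∃ (h : X₂ → ℝ) (τ : X₂ → X₁), Measurable h ∧ (∀ y, 0 < h y) ∧
      Measure.QuasiMeasurePreserving τ m₂ m₁ ∧
      ∀ f : Lp ℝ 2 m₁, U f =ᵐ[m₂] fun y => h y * f (τ y) := by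
  obtain ⟨V, hV⟩ := hU.exists_continuousLinearMap
  obtain ⟨w, hwm, hw0, hw⟩ := exists_pos_memLp_two m₁
  obtain ⟨w', -, hw0', hw'⟩ := exists_pos_memLp_two m₂
  set W : Lp ℝ 2 m₁ := hw.toLp w
  set W' : Lp ℝ 2 m₂ := hw'.toLp w'
  have hWw : ∀ᵐ x ∂m₁, W x = w x := hw.coeFn_toLp
  have hWw' : ∀ᵐ y ∂m₂, W' y = w' y := hw'.coeFn_toLp
  have hW : ∀ᵐ x ∂m₁, 0 < W x := hWw.mono fun x hx => hx ▸ hw0 x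
  have hW' : ∀ᵐ y ∂m₂, 0 < W' y := hWw'.mono fun y hy => hy ▸ hw0' y
  have hW'0 : 0 ≤ W' := (Lp.coeFn_nonneg W').1 <| hW'.mono fun x hx => hx.le
  have hUW := hU.map_pos hW
  obtain ⟨τ, hτ, hmap⟩ := hU.exists_map_withDensity_eq V hV hW
  have hUm : Measurable (U W) := (Lp.stronglyMeasurable (U W)).measurable
  have hqmp : Measure.QuasiMeasurePreserving τ m₂ m₁ := by
    refine ⟨hτ, Measure.AbsolutelyContinuous.mk fun A hA h0 => ?_⟩
    have h1 : (m₂.withDensity fun y => ENNReal.ofReal (U W y * W' y)).map τ A = 0 := by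
      rw [hmap W' hW'0]
      exact withDensity_absolutelyContinuous _ _ h0
    rw [Measure.map_apply hτ hA, withDensity_apply _ (hτ hA),
      lintegral_eq_zero_iff (measurable_ofReal_mul_Lp _ _)] at h1
    rw [Measure.map_apply hτ hA, ← Measure.restrict_eq_zero, ← ae_eq_bot]
    refine eventually_false_iff_eq_bot.1 ?_
    filter_upwards [h1, ae_restrict_of_ae hUW, ae_restrict_of_ae hW'] with y h2 h3 h4
    have := mul_pos h3 h4
    simp only [Pi.zero_apply, ENNReal.ofReal_eq_zero] at h2
    linarith
  set h : X₂ → ℝ := fun y => if 0 < U W y then U W y / w (τ y) else 1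
  have hhm : Measurable h :=
    Measurable.ite (measurableSet_lt measurable_const hUm) (hUm.div (hwm.comp hτ)) measurable_const
  have hh0 : ∀ y, 0 < h y := fun y => by
    by_cases hy : 0 < U W y
    · simp only [h, hy, if_true]; exact div_pos hy (hw0 _)
    · simp only [h, hy, if_false]; exact one_pos
  have hpos : ∀ f : Lp ℝ 2 m₁, 0 ≤ f → U f =ᵐ[m₂] fun y => h y * f (τ y) := by
    intro f hf
    have hfm : Measurable f := (Lp.stronglyMeasurable f).measurable
    have hUf := hU.nonneg f hf
    have key : (fun y => ENNReal.ofReal (U f y * W' y)) =ᵐ[m₂]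
        fun y => ENNReal.ofReal (h y * f (τ y) * W' y) := by
      refine ae_eq_of_forall_setLIntegral_eq_of_sigmaFinite
        (measurable_ofReal_mul_Lp _ _)
        (((hhm.mul (hfm.comp hτ)).mul (Lp.stronglyMeasurable W').measurable).ennreal_ofReal)
        fun B hB _ => ?_
      set g : Lp ℝ 2 m₂ := indLp hB W'
      have hgB := coeFn_indLp hB W'
      have hg0 : 0 ≤ g := by
        rw [← Lp.coeFn_nonneg]
        filter_upwards [hgB, hW'] with y h1 h2
        rw [h1]
        exact Set.indicator_apply_nonneg fun _ => h2.le
      have hadj : 0 ≤ V.adjoint g := nonneg_of_forall_inner_nonneg fun f hf => by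
        rw [V.adjoint_inner_left, hV]
        exact inner_nonneg_of_nonneg hg0 (hU.nonneg f hf)
      have hset : ∀ F : X₂ → ℝ, ∫⁻ y in B, ENNReal.ofReal (F y * W' y) ∂m₂ =
          ∫⁻ y, ENNReal.ofReal (F y * g y) ∂m₂ := fun F => by
        rw [← lintegral_indicator hB]
        refine lintegral_congr_ae ?_
        filter_upwards [hgB] with y hy
        rw [hy]
        by_cases hyB : y ∈ B <;> simp [hyB]
      rw [hset, hset, lintegral_ofReal_mul hUf hg0, ← hV, ← V.adjoint_inner_right,
        ← lintegral_ofReal_mul hf hadj]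
      have hq : Measurable fun x => ENNReal.ofReal (f x / w x) := (hfm.div hwm).ennreal_ofReal
      calc ∫⁻ x, ENNReal.ofReal (f x * V.adjoint g x) ∂m₁
          = ∫⁻ x, ENNReal.ofReal (f x / w x)
              ∂(m₁.withDensity fun x => ENNReal.ofReal (W x * V.adjoint g x)) := by
            rw [lintegral_withDensity_eq_lintegral_mul _
              (measurable_ofReal_mul_Lp _ _) hq]
            refine lintegral_congr_ae ?_
            filter_upwards [hWw, (Lp.coeFn_nonneg f).2 hf,
              (Lp.coeFn_nonneg (V.adjoint g)).2 hadj] with x h1 h2 h3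
            simp only [Pi.zero_apply] at h2 h3
            rw [Pi.mul_apply, ← ENNReal.ofReal_mul (by rw [h1]; exact mul_nonneg (hw0 x).le h3), h1]
            congr 1
            field_simp [(hw0 x).ne']
        _ = ∫⁻ y, ENNReal.ofReal (f (τ y) / w (τ y))
              ∂(m₂.withDensity fun y => ENNReal.ofReal (U W y * g y)) := by
            rw [← hmap g hg0, lintegral_map hq hτ]
        _ = ∫⁻ y, ENNReal.ofReal (h y * f (τ y) * g y) ∂m₂ := by
            have hqτ : Measurable fun y => ENNReal.ofReal (f (τ y) / w (τ y)) := hq.comp hτ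
            rw [lintegral_withDensity_eq_lintegral_mul _ (measurable_ofReal_mul_Lp _ _) hqτ]
            refine lintegral_congr_ae ?_
            filter_upwards [hUW, (Lp.coeFn_nonneg g).2 hg0] with y h1 h2
            rw [Pi.mul_apply, ← ENNReal.ofReal_mul (mul_nonneg h1.le h2)]
            simp only [h, h1, if_true]
            congr 1
            ring
    filter_upwards [key, hqmp.ae ((Lp.coeFn_nonneg f).2 hf), hW', (Lp.coeFn_nonneg _).2 hUf]
      with y h1 h2 h3 h4
    have h5 := (ENNReal.ofReal_eq_ofReal_iff (mul_nonneg h4 h3.le)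
      (mul_nonneg (mul_nonneg (hh0 y).le h2) h3.le)).1 h1
    exact mul_right_cancel₀ h3.ne' h5
  refine ⟨h, τ, hhm, hh0, hqmp, fun f => ?_⟩
  have hsplit : (f⁺ : Lp ℝ 2 m₁) - f⁻ = f := posPart_sub_negPart f
  have h1 : ∀ᵐ x ∂m₁, f x = (f⁺ : Lp ℝ 2 m₁) x - (f⁻ : Lp ℝ 2 m₁) x := by
    have := Lp.coeFn_sub (f⁺ : Lp ℝ 2 m₁) f⁻
    rw [hsplit] at this
    exact this
  have h2 : U f = U f⁺ - U f⁻ := by rw [← map_sub, hsplit]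
  rw [h2]
  filter_upwards [Lp.coeFn_sub (U f⁺) (U f⁻), hpos _ (posPart_nonneg f),
    hpos _ (negPart_nonneg f), hqmp.ae h1] with y h3 h4 h5 h6
  rw [h3, Pi.sub_apply, h4, h5, h6, mul_sub]

/-- The transformations of `U` and `U⁻¹` are inverse to each other: testing `U (U⁻¹ g) = g` with `w`
and `e w`, where `w > 0` and `e` is injective, shows that `e ∘ σ ∘ τ = e`. -/
theorem comp_transformation_ae_eq [StandardBorelSpace X₂] [SigmaFinite m₂]
    {h : X₂ → ℝ} {τ : X₂ → X₁} {k : X₁ → ℝ} {σ : X₁ → X₂}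
    (hτ : Measure.QuasiMeasurePreserving τ m₂ m₁) (hσ : Measure.QuasiMeasurePreserving σ m₁ m₂)
    (hh : ∀ f : Lp ℝ 2 m₁, U f =ᵐ[m₂] fun y => h y * f (τ y))
    (hk : ∀ g : Lp ℝ 2 m₂, U.symm g =ᵐ[m₁] fun x => k x * g (σ x)) :
    ∀ᵐ y ∂m₂, σ (τ y) = y := by
  obtain ⟨w, -, hw0, hw⟩ := exists_pos_memLp_two m₂
  obtain ⟨e, he, he2⟩ := exists_measurableEmbedding_real_bounded X₂
  have hew : MemLp (fun y => e y * w y) 2 m₂ :=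
    hw.of_le_mul (c := 2) (he.measurable.aestronglyMeasurable.mul hw.1)
      (Eventually.of_forall fun x => by
        rw [norm_mul]; exact mul_le_mul_of_nonneg_right (he2 x) (norm_nonneg _))
  have key : ∀ (g : X₂ → ℝ) (hg : MemLp g 2 m₂),
      ∀ᵐ y ∂m₂, g y = h y * (k (τ y) * g (σ (τ y))) := by
    intro g hg
    have h1 := hh (U.symm (hg.toLp g))
    rw [U.apply_symm_apply] at h1
    filter_upwards [h1, hg.coeFn_toLp, hτ.ae (hk (hg.toLp g)), hτ.ae (hσ.ae hg.coeFn_toLp)]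
      with y h2 h3 h4 h5
    rw [← h5, ← h4, ← h2, h3]
  filter_upwards [key w hw, key _ hew] with y h1 h2
  refine he.injective (mul_right_cancel₀ (hw0 y).ne' ?_)
  rw [h2]
  nth_rewrite 1 [h1]
  ring

theorem exists_isScalingTransformation [StandardBorelSpace X₁] [StandardBorelSpace X₂] [Nonempty X₁]
    [Nonempty X₂] [SigmaFinite m₁] [SigmaFinite m₂] (hU : IsOrderIsomorphism U) :
    ∃ (h : X₂ → ℝ) (τ : X₂ → X₁), IsScalingTransformation U h τ := by
  obtain ⟨h, τ, hm, h0, hτ, hh⟩ := hU.exists_apply_ae_eq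
  obtain ⟨k, σ, -, -, hσ, hk⟩ := hU.symm.exists_apply_ae_eq
  refine ⟨h, τ, hm, h0, hτ.measurable, ⟨σ, hσ.measurable, ?_, ?_⟩, fun f hf => ?_⟩
  · exact comp_transformation_ae_eq hτ hσ hh hk
  · exact comp_transformation_ae_eq (U := U.symm) hσ hτ hk (by simpa using hh)
  · filter_upwards [hh (hf.toLp f), hτ.ae hf.coeFn_toLp] with y h1 h2
    rw [h1, h2]

end IsOrderIsomorphism

end Representation

/-! ### Irreducibility and intertwining order isomorphisms -/

section Intertwining

variable {X : Type*} [MeasurableSpace X] {m : Measure X} [SigmaFinite m]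

/-- `A` is invariant if every `T_t` maps functions supported in `A` to functions supported in `A`. -/
theorem IsMarkovianSemigroup.isInvariantSet {T : ℝ≥0 → Lp ℝ 2 m →L[ℝ] Lp ℝ 2 m}
    (hT : IsMarkovianSemigroup T) {A : Set X} (hA : MeasurableSet A)
    (h : ∀ t f, 0 ≤ f → (∀ᵐ x ∂m, x ∉ A → f x = 0) → ∀ᵐ x ∂m, x ∉ A → T t f x = 0) :
    IsInvariantSet T hA := by
  intro t
  have hind : indClass m hA =ᵐ[m] A.indicator fun _ => 1 := AEEqFun.coeFn_mk _ _
  have hle : indClass m hA ≤ 1 := by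
    rw [← AEEqFun.coeFn_le]
    filter_upwards [hind, AEEqFun.coeFn_one (α := X) (μ := m) (β := ℝ≥0∞)] with x h1 h2
    rw [h1, h2]
    exact Set.indicator_apply_le' (fun _ => le_rfl) fun _ => zero_le_one
  have h0 : ∀ᵐ x ∂m, ∀ n, x ∉ A → T t (truncLp (indClass m hA) n) x = 0 := by
    refine ae_all_iff.2 fun n => h t _ (truncLp_nonneg _ n) ?_
    filter_upwards [coeFn_truncLp (indClass m hA) n, hind] with x h1 h2 hx
    rw [h1, truncFun, Set.indicator_apply_eq_zero, h2, Set.indicator_of_notMem hx]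
    simp
  have h1 : ∀ᵐ x ∂m, ∀ n, T t (truncLp (indClass m hA) n) x ≤
      T t (truncLp (1 : X →ₘ[m] ℝ≥0∞) n) x :=
    ae_all_iff.2 fun n => (Lp.coeFn_le _ _).2 <|
      monotone_of_map_nonneg (T t).toLinearMap (hT.nonneg t) (truncLp_mono hle le_rfl)
  have hone : ∀ᵐ x ∂m, posExt (T t) 1 x = ⨆ n, ENNReal.ofReal (T t (truncLp 1 n) x) :=
    AEEqFun.coeFn_mk _ _
  have hA' : ∀ᵐ x ∂m, posExt (T t) (indClass m hA) x =
      ⨆ n, ENNReal.ofReal (T t (truncLp (indClass m hA) n) x) :=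
    AEEqFun.coeFn_mk _ _
  rw [← AEEqFun.coeFn_le]
  filter_upwards [h0, h1, hone, hA', hind, AEEqFun.coeFn_le.2 (hT.posExt_one_le t),
    AEEqFun.coeFn_one (α := X) (μ := m) (β := ℝ≥0∞)] with x h0 h1 h2 h3 h4 h5 h6
  rw [h3, h4]
  by_cases hx : x ∈ A
  · rw [Set.indicator_of_mem hx]
    rw [h2, h6] at h5
    exact (iSup_mono fun n => ENNReal.ofReal_le_ofReal (h1 n)).trans h5
  · simp [h0 _ hx]

/-- Let `P` be a multiplication operator, with multiplier `P w / w` for some `w > 0`. If `P` commutes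
with an irreducible Markovian semigroup, then `P` is a multiple of the identity. Indeed the sets
`{P w ≤ c w}` are invariant: if `f ≥ 0` is supported in such a set, then `P f ≤ c f`, hence
`P (T_t f) = T_t (P f) ≤ c T_t f`, so that `T_t f` vanishes where `P w > c w`. -/
theorem exists_eq_smul_of_commute {T : ℝ≥0 → Lp ℝ 2 m →L[ℝ] Lp ℝ 2 m}
    (hT : IsMarkovianSemigroup T) (hirr : IsIrreducibleSemigroup T)
    (P : Lp ℝ 2 m →L[ℝ] Lp ℝ 2 m) (hPT : ∀ t f, P (T t f) = T t (P f))
    {W : Lp ℝ 2 m} (hW : ∀ᵐ x ∂m, 0 < W x) (hP : ∀ f, ∀ᵐ x ∂m, P f x * W x = P W x * f x) :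
    ∃ c : ℝ, ∀ f, P f = c • f := by
  have hWm : Measurable W := (Lp.stronglyMeasurable W).measurable
  have hPm : Measurable (P W) := (Lp.stronglyMeasurable (P W)).measurable
  have hdich : ∀ c : ℝ, (∀ᵐ x ∂m, P W x / W x ≤ c) ∨ ∀ᵐ x ∂m, ¬ P W x / W x ≤ c := by
    intro c
    set A : Set X := {x | P W x ≤ c * W x}
    have hA : MeasurableSet A := measurableSet_le hPm (hWm.const_mul c)
    have hinv : IsInvariantSet T hA := by
      refine hT.isInvariantSet hA fun t f hf hfA => ?_
      have h1 : P f ≤ c • f := by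
        rw [← Lp.coeFn_le]
        filter_upwards [hP f, hW, hfA, (Lp.coeFn_nonneg f).2 hf, Lp.coeFn_smul c f]
          with x h2 h3 h4 h5 h6
        rw [h6, Pi.smul_apply, smul_eq_mul]
        refine le_of_mul_le_mul_right ?_ h3
        rw [h2]
        by_cases hx : x ∈ A
        · calc P W x * f x ≤ c * W x * f x := mul_le_mul_of_nonneg_right hx h5
            _ = c * f x * W x := by ring
        · simp [h4 hx]
      have h2 : P (T t f) ≤ c • T t f := by
        rw [hPT, ← map_smul]
        exact monotone_of_map_nonneg (T t).toLinearMap (hT.nonneg t) h1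
      filter_upwards [(Lp.coeFn_le _ _).2 h2, hP (T t f), hW, Lp.coeFn_smul c (T t f),
        (Lp.coeFn_nonneg _).2 (hT.nonneg t f hf)] with x h3 h4 h5 h6 h7 hx
      rw [h6, Pi.smul_apply, smul_eq_mul] at h3
      have h8 : P W x * T t f x ≤ c * W x * T t f x := by
        rw [← h4]
        calc P (T t f) x * W x ≤ c * T t f x * W x := mul_le_mul_of_nonneg_right h3 h5.le
          _ = c * W x * T t f x := by ring
      have h9 : c * W x < P W x := not_le.1 hx
      simp only [Pi.zero_apply] at h7
      rcases h7.eq_or_lt with h10 | h10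
      · exact h10.symm
      · exact absurd h8 (not_le.2 (mul_lt_mul_of_pos_right h9 h10))
    rcases hirr A hA hinv with h | h
    · right
      filter_upwards [measure_eq_zero_iff_ae_notMem.1 h, hW] with x h1 h2
      rwa [div_le_iff₀ h2]
    · left
      filter_upwards [measure_eq_zero_iff_ae_notMem.1 h, hW] with x h1 h2
      rw [div_le_iff₀ h2]
      exact not_not.1 h1
  have : HasCountableSeparatingOn ℝ (fun s => ∃ c : ℝ, s = Set.Iic c) Set.univ := by
    refine ⟨⟨Set.range fun q : ℚ => Set.Iic (q : ℝ), Set.countable_range _, ?_, ?_⟩⟩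
    · rintro _ ⟨q, rfl⟩
      exact ⟨q, rfl⟩
    · intro x _ y _ hxy
      refine le_antisymm ?_ ?_
      · exact le_of_forall_lt_rat_imp_le fun q hq =>
          (hxy _ ⟨q, rfl⟩).2 hq.le
      · exact le_of_forall_lt_rat_imp_le fun q hq =>
          (hxy _ ⟨q, rfl⟩).1 hq.le
  obtain ⟨c, hc⟩ := exists_eventuallyEq_const_of_forall_separating (l := ae m)
    (f := fun x => P W x / W x) (fun s => ∃ c : ℝ, s = Set.Iic c) (by
      rintro _ ⟨c, rfl⟩
      exact hdich c)
  refine ⟨c, fun f => Lp.ext ?_⟩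
  filter_upwards [hc, hP f, hW, Lp.coeFn_smul c f] with x h1 h2 h3 h4
  rw [h4, Pi.smul_apply, smul_eq_mul]
  rw [Function.const_apply, div_eq_iff h3.ne'] at h1
  rw [h1] at h2
  refine mul_right_cancel₀ h3.ne' ?_
  rw [h2]
  ring

variable {X₁ X₂ : Type*} [MeasurableSpace X₁] [MeasurableSpace X₂]
  {m₁ : Measure X₁} {m₂ : Measure X₂} {U : Lp ℝ 2 m₁ ≃ₗ[ℝ] Lp ℝ 2 m₂}

/-- If `U f = h · (f ∘ τ)`, then `U* U` is a multiplication operator. Indeed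
`⟨U* U f, 1_B g⟩ = ∫ h² (f g 1_B) ∘ τ` is symmetric in `f` and `g`. -/
theorem adjoint_apply_mul_ae_eq (V : Lp ℝ 2 m₁ →L[ℝ] Lp ℝ 2 m₂) (hV : ∀ f, V f = U f)
    {h : X₂ → ℝ} {τ : X₂ → X₁} (hτ : Measure.QuasiMeasurePreserving τ m₂ m₁)
    (hh : ∀ f : Lp ℝ 2 m₁, U f =ᵐ[m₂] fun y => h y * f (τ y)) (f g : Lp ℝ 2 m₁) :
    ∀ᵐ x ∂m₁, V.adjoint (V f) x * g x = V.adjoint (V g) x * f x := by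
  refine Integrable.ae_eq_of_forall_setIntegral_eq _ _ (integrable_mul_Lp _ _)
    (integrable_mul_Lp _ _) fun B hB _ => ?_
  have key : ∀ f g : Lp ℝ 2 m₁, ∫ x in B, V.adjoint (V f) x * g x ∂m₁ =
      ∫ y, U f y * U (indLp hB g) y ∂m₂ := fun f g => by
    simp_rw [mul_comm _ ((g : X₁ → ℝ) _)]
    rw [← inner_indLp_left hB, V.adjoint_inner_right, hV, hV, inner_eq_integral_mul]
    simp_rw [mul_comm]
  rw [key, key]
  refine integral_congr_ae ?_
  filter_upwards [hh f, hh g, hh (indLp hB f), hh (indLp hB g), hτ.ae (coeFn_indLp hB f),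
    hτ.ae (coeFn_indLp hB g)] with y h1 h2 h3 h4 h5 h6
  rw [h1, h2, h3, h4, h5, h6]
  by_cases hy : τ y ∈ B
  · simp only [Set.indicator_of_mem hy]; ring
  · simp only [Set.indicator_of_notMem hy]; ring

/-- `U* U` commutes with an irreducible semigroup, hence is a multiple of the identity. -/
theorem exists_inner_map_map_eq [StandardBorelSpace X₁] [Nonempty X₁] [SigmaFinite m₁]
    [SigmaFinite m₂] (hU : IsOrderIsomorphism U)
    {T₁ : ℝ≥0 → Lp ℝ 2 m₁ →L[ℝ] Lp ℝ 2 m₁} {T₂ : ℝ≥0 → Lp ℝ 2 m₂ →L[ℝ] Lp ℝ 2 m₂}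
    (hT₁ : IsMarkovianSemigroup T₁) (hT₂ : IsMarkovianSemigroup T₂)
    (hirr₁ : IsIrreducibleSemigroup T₁) (hint : Intertwines U T₁ T₂) :
    ∃ c : ℝ, ∀ f g, (inner ℝ (U f) (U g) : ℝ) = c * inner ℝ f g := by
  obtain ⟨V, hV⟩ := hU.exists_continuousLinearMap
  obtain ⟨h, τ, -, -, hτ, hh⟩ := hU.exists_apply_ae_eq
  obtain ⟨w, -, hw0, hw⟩ := exists_pos_memLp_two m₁
  have hW : ∀ᵐ x ∂m₁, 0 < hw.toLp w x := hw.coeFn_toLp.mono fun x hx => hx ▸ hw0 x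
  obtain ⟨c, hc⟩ := exists_eq_smul_of_commute hT₁ hirr₁ (V.adjoint ∘L V) (fun t f => by
      refine ext_inner_right ℝ fun g => ?_
      rw [hT₁.symmetric]
      simp only [ContinuousLinearMap.comp_apply, V.adjoint_inner_left, hV]
      rw [hint, hint, hT₂.symmetric]) hW
    (fun f => adjoint_apply_mul_ae_eq V hV hτ hh f _)
  refine ⟨c, fun f g => ?_⟩
  rw [← hV, ← hV, ← V.adjoint_inner_left, ← real_inner_smul_left, ← hc f,
    ContinuousLinearMap.comp_apply]

/-- If `⟨U f, U g⟩ = c ⟨f, g⟩`, then `τ_# (h² m₂)` and `c m₁` agree on the sets `A` of finite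
`m₁`-measure: both have the value `‖U 1_A‖²`. -/
theorem IsScalingTransformation.map_withDensity_eq [SigmaFinite m₁] {c : ℝ} {h : X₂ → ℝ}
    {τ : X₂ → X₁} (hs : IsScalingTransformation U h τ) (hc : ∀ f, ‖U f‖ ^ 2 = c * ‖f‖ ^ 2) :
    (m₂.withDensity fun y => ENNReal.ofReal (h y ^ 2)).map τ = ENNReal.ofReal c • m₁ := by
  set μ := (m₂.withDensity fun y => ENNReal.ofReal (h y ^ 2)).map τ
  have hfin : ∀ A, MeasurableSet A → m₁ A ≠ ∞ → μ A = ENNReal.ofReal c * m₁ A := by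
    intro A hA hmA
    have hmem : MemLp (A.indicator fun _ => (1 : ℝ)) 2 m₁ :=
      memLp_indicator_const 2 hA 1 (Or.inr hmA)
    have h1 := hs.apply_ae_eq _ hmem
    have h2 : ENNReal.ofReal (‖hmem.toLp _‖ ^ 2) = m₁ A := by
      rw [ofReal_norm_sq_eq_lintegral, ← lintegral_indicator_one hA]
      refine lintegral_congr_ae ?_
      filter_upwards [hmem.coeFn_toLp] with x hx
      rw [hx]
      by_cases hxA : x ∈ A <;> simp [hxA]
    have h3 : ENNReal.ofReal (‖U (hmem.toLp _)‖ ^ 2) = μ A := by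
      rw [ofReal_norm_sq_eq_lintegral, Measure.map_apply hs.measurable_transformation hA,
        withDensity_apply _ (hs.measurable_transformation hA),
        ← lintegral_indicator (hs.measurable_transformation hA)]
      refine lintegral_congr_ae ?_
      filter_upwards [h1] with y hy
      rw [hy]
      by_cases hyA : τ y ∈ A
      · simp [hyA]
      · simp [hyA]
    rw [← h3, ← h2, hc, ENNReal.ofReal_mul' (sq_nonneg _)]
  refine (Measure.ext_iff_of_iUnion_eq_univ (iUnion_spanningSets m₁)).2 fun n =>
    Measure.ext fun A hA => ?_
  rw [Measure.restrict_apply hA, Measure.restrict_apply hA, Measure.smul_apply, smul_eq_mul]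
  exact hfin _ (hA.inter (measurableSet_spanningSets m₁ n)) (measure_ne_top_of_subset
    Set.inter_subset_right (measure_spanningSets_lt_top m₁ n).ne)

end Intertwining

/-! ### The Dirichlet form -/

section Form

/-- A continuous midpoint-convex function on `[0, ∞)` lies below its chords from `0`. Otherwise the
difference attains a positive maximum in the interior of `[0, t]`, and the leftmost point where it is
attained contradicts midpoint convexity. -/
theorem mul_sub_le_mul_sub_of_midpoint_convex {u : ℝ → ℝ} (hu : Continuous u)
    (hmid : ∀ x d, 0 ≤ d → d ≤ x → 2 * u x ≤ u (x - d) + u (x + d)) {s t : ℝ} (hs : 0 ≤ s)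
    (hst : s ≤ t) : s * (u 0 - u t) ≤ t * (u 0 - u s) := by
  rcases (hs.trans hst).eq_or_lt with rfl | ht
  · have : s = 0 := le_antisymm hst hs
    simp [this]
  set v : ℝ → ℝ := fun x => t * (u x - u 0) + x * (u 0 - u t)
  have hv : Continuous v := by fun_prop
  have hv0 : v 0 = 0 := by simp [v]
  have hvt : v t = 0 := by simp only [v]; ring
  have hvmid : ∀ x d, 0 ≤ d → d ≤ x → 2 * v x ≤ v (x - d) + v (x + d) := fun x d h1 h2 => by
    have := mul_le_mul_of_nonneg_left (hmid x d h1 h2) ht.le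
    simp only [v]
    linarith
  suffices h : v s ≤ 0 by simp only [v] at h; linarith
  obtain ⟨x₀, hx₀, hmax⟩ := isCompact_Icc.exists_isMaxOn (Set.nonempty_Icc.2 ht.le) hv.continuousOn
  refine (hmax (⟨hs, hst⟩ : s ∈ Set.Icc 0 t)).trans ?_
  by_contra! hM
  have hK : IsCompact (Set.Icc 0 t ∩ v ⁻¹' {v x₀}) :=
    isCompact_Icc.inter_right (isClosed_singleton.preimage hv)
  obtain ⟨c, ⟨⟨hc0, hct⟩, hc⟩, hleast⟩ := hK.exists_isLeast ⟨x₀, hx₀, rfl⟩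
  have hc : v c = v x₀ := hc
  have hc0' : 0 < c := lt_of_le_of_ne hc0 fun h => by rw [← h, hv0] at hc; linarith
  have hct' : c < t := lt_of_le_of_ne hct fun h => by rw [h, hvt] at hc; linarith
  set d := min c (t - c)
  have hd : 0 < d := lt_min hc0' (sub_pos.2 hct')
  have hd1 : d ≤ c := min_le_left _ _
  have hd2 : d ≤ t - c := min_le_right _ _
  have h1 : v (c - d) ≤ v x₀ := hmax (⟨by linarith, by linarith⟩ : c - d ∈ Set.Icc 0 t)
  have h2 : v (c + d) ≤ v x₀ := hmax (⟨by linarith, by linarith⟩ : c + d ∈ Set.Icc 0 t)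
  have h3 : v (c - d) ≠ v x₀ := fun h => by
    have := hleast (⟨⟨by linarith, by linarith⟩, h⟩ : c - d ∈ Set.Icc 0 t ∩ v ⁻¹' {v x₀})
    linarith
  have h4 := hvmid c d hd.le hd1
  have h5 := lt_of_le_of_ne h1 h3
  linarith

variable {X : Type*} [MeasurableSpace X] {m : Measure X} [SigmaFinite m]
  {T : ℝ≥0 → Lp ℝ 2 m →L[ℝ] Lp ℝ 2 m}

namespace IsMarkovianSemigroup

theorem continuous_apply (hT : IsMarkovianSemigroup T) (f : Lp ℝ 2 m) :
    Continuous fun t => T t f := by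
  have hle : ∀ s t, s ≤ t → ‖T s f - T t f‖ ≤ ‖T (t - s) f - f‖ := fun s t h => by
    have h1 : T t f = T s (T (t - s) f) := by rw [← hT.add_apply, add_tsub_cancel_of_le h]
    rw [h1, ← map_sub, norm_sub_rev (T (t - s) f)]
    exact hT.contraction s _
  have h0 : Tendsto (fun t => ‖T t f - f‖) (𝓝 0) (𝓝 0) := by
    simpa using ((hT.tendsto_zero f).sub_const f).norm
  refine continuous_iff_continuousAt.2 fun t => ?_
  rw [ContinuousAt, tendsto_iff_norm_sub_tendsto_zero]
  have h1 : Tendsto (fun s : ℝ≥0 => ‖T (t - s) f - f‖ + ‖T (s - t) f - f‖) (𝓝 t) (𝓝 (0 + 0)) := by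
    refine Tendsto.add (h0.comp ?_) (h0.comp ?_)
    · simpa using (tendsto_const_nhds (x := t)).sub (tendsto_id (x := 𝓝 t))
    · simpa using (tendsto_id (x := 𝓝 t)).sub (tendsto_const_nhds (x := t))
  rw [add_zero] at h1
  refine squeeze_zero (fun s => norm_nonneg _) (fun s => ?_) h1
  rcases le_total s t with h | h
  · exact (hle s t h).trans (le_add_of_nonneg_right (norm_nonneg _))
  · rw [norm_sub_rev]
    exact (hle t s h).trans (le_add_of_nonneg_left (norm_nonneg _))

theorem inner_add_apply (hT : IsMarkovianSemigroup T) (s t : ℝ≥0) (f : Lp ℝ 2 m) :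
    (inner ℝ (T (s + t) f) f : ℝ) = inner ℝ (T s f) (T t f) := by
  rw [add_comm, hT.add_apply, hT.symmetric]

/-- The approximating forms `(1/t) ⟨f - T_t f, f⟩` increase as `t` decreases to `0`, because
`t ↦ ⟨T_t f, f⟩ = ‖T_{t/2} f‖²` is convex. -/
theorem antitoneOn_approxForm (hT : IsMarkovianSemigroup T) (f : Lp ℝ 2 m) :
    AntitoneOn (fun t : ℝ≥0 => (1 / (t : ℝ)) * inner ℝ (f - T t f) f) (Set.Ioi 0) := by
  set u : ℝ → ℝ := fun x => inner ℝ (T x.toNNReal f) f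
  have hu : Continuous u :=
    ((hT.continuous_apply f).comp continuous_real_toNNReal).inner continuous_const
  have hmid : ∀ x d, 0 ≤ d → d ≤ x → 2 * u x ≤ u (x - d) + u (x + d) := by
    intro x d hd hdx
    set a := ((x - d) / 2).toNNReal
    set b := ((x + d) / 2).toNNReal
    have h1 : x.toNNReal = a + b := by
      rw [← Real.toNNReal_add (by linarith) (by linarith)]; congr 1; ring
    have h2 : (x - d).toNNReal = a + a := by
      rw [← Real.toNNReal_add (by linarith) (by linarith)]; congr 1; ring
    have h3 : (x + d).toNNReal = b + b := by
      rw [← Real.toNNReal_add (by linarith) (by linarith)]; congr 1; ring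
    simp only [u, h1, h2, h3, hT.inner_add_apply]
    have h4 : (0 : ℝ) ≤ inner ℝ (T a f - T b f) (T a f - T b f) := real_inner_self_nonneg
    rw [inner_sub_left, inner_sub_right, inner_sub_right, real_inner_comm (T a f) (T b f)] at h4
    linarith
  intro s hs t ht hst
  have hs' : (0 : ℝ) < s := hs
  have ht' : (0 : ℝ) < t := ht
  have key := mul_sub_le_mul_sub_of_midpoint_convex hu hmid hs'.le (NNReal.coe_le_coe.2 hst)
  simp only [u, Real.toNNReal_zero, Real.toNNReal_coe, hT.zero_apply] at key
  simp only [inner_sub_left, one_div, inv_mul_eq_div]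
  rw [div_le_div_iff₀ ht' hs']
  linarith

/-- Since the approximating forms are monotone, `f ∈ D(Q)` iff they are bounded at `f`. -/
theorem mem_formDomain_iff (hT : IsMarkovianSemigroup T) (f : Lp ℝ 2 m) :
    f ∈ formDomain T ↔ ∃ C : ℝ, ∀ t : ℝ≥0, 0 < t → (1 / (t : ℝ)) * inner ℝ (f - T t f) f ≤ C := by
  have hanti := hT.antitoneOn_approxForm f
  constructor
  · rintro ⟨q, hq⟩
    refine ⟨q, fun t ht => ge_of_tendsto hq ?_⟩
    filter_upwards [Ioo_mem_nhdsGT ht] with s hs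
    exact hanti hs.1 ht hs.2.le
  · rintro ⟨C, hC⟩
    exact ⟨_, hanti.tendsto_nhdsGT ⟨C, by rintro _ ⟨t, ht, rfl⟩; exact hC t ht⟩⟩

theorem approxForm_nonneg (hT : IsMarkovianSemigroup T) (f : Lp ℝ 2 m) (t : ℝ≥0) :
    0 ≤ (1 / (t : ℝ)) * inner ℝ (f - T t f) f := by
  refine mul_nonneg (by positivity) ?_
  rw [inner_sub_left, real_inner_self_eq_norm_sq, sub_nonneg, pow_two]
  exact (real_inner_le_norm _ _).trans
    (mul_le_mul_of_nonneg_right (hT.contraction t f) (norm_nonneg f))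

theorem add_mem_formDomain (hT : IsMarkovianSemigroup T) {f g : Lp ℝ 2 m} (hf : f ∈ formDomain T)
    (hg : g ∈ formDomain T) : f + g ∈ formDomain T := by
  rw [hT.mem_formDomain_iff] at *
  obtain ⟨C, hC⟩ := hf
  obtain ⟨D, hD⟩ := hg
  refine ⟨2 * C + 2 * D, fun t ht => ?_⟩
  -- the parallelogram law
  have h := hT.approxForm_nonneg (f - g) t
  have h1 := hC t ht
  have h2 := hD t ht
  simp only [map_add, map_sub, inner_sub_left, inner_add_left, inner_sub_right, inner_add_right,
    mul_sub, mul_add] at *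
  linarith

/-- `Q(f, g)` exists for all `f, g ∈ D(Q)`, by polarization. -/
theorem exists_hasFormValue (hT : IsMarkovianSemigroup T) {f g : Lp ℝ 2 m} (hf : f ∈ formDomain T)
    (hg : g ∈ formDomain T) : ∃ q, HasFormValue T f g q := by
  obtain ⟨a, ha⟩ := hT.add_mem_formDomain hf hg
  obtain ⟨b, hb⟩ := hf
  obtain ⟨c, hc⟩ := hg
  refine ⟨(a - b - c) / 2, (((ha.sub hb).sub hc).div_const 2).congr fun t => ?_⟩
  have h1 : (inner ℝ (T t g) f : ℝ) = inner ℝ (T t f) g := by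
    rw [hT.symmetric, real_inner_comm]
  have h2 : (inner ℝ g f : ℝ) = inner ℝ f g := real_inner_comm _ _
  simp only [map_add, inner_sub_left, inner_add_left, inner_add_right, h1, h2]
  ring

end IsMarkovianSemigroup

variable {X₁ X₂ : Type*} [MeasurableSpace X₁] [MeasurableSpace X₂]
  {m₁ : Measure X₁} {m₂ : Measure X₂} {U : Lp ℝ 2 m₁ ≃ₗ[ℝ] Lp ℝ 2 m₂}

theorem Intertwines.hasFormValue_map [SigmaFinite m₁] [SigmaFinite m₂]
    {T₁ : ℝ≥0 → Lp ℝ 2 m₁ →L[ℝ] Lp ℝ 2 m₁} {T₂ : ℝ≥0 → Lp ℝ 2 m₂ →L[ℝ] Lp ℝ 2 m₂}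
    (hint : Intertwines U T₁ T₂) {c : ℝ}
    (hc : ∀ f g, (inner ℝ (U f) (U g) : ℝ) = c * inner ℝ f g) {f g : Lp ℝ 2 m₁} {q : ℝ}
    (h : HasFormValue T₁ f g q) : HasFormValue T₂ (U f) (U g) (c * q) := by
  refine (h.const_mul c).congr fun t => ?_
  rw [← hint, ← map_sub, hc]
  ring

end Form

end IntertwiningL2

/-! ### Intertwining order isomorphisms are multiples of unitary operators -/

open IntertwiningL2
theorem corollary2p6 {X₁ X₂ : Type*} [MeasurableSpace X₁] [StandardBorelSpace X₁]
    [MeasurableSpace X₂] [StandardBorelSpace X₂]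
    (m₁ : Measure X₁) [SigmaFinite m₁] (m₂ : Measure X₂) [SigmaFinite m₂] (hm₁ : m₁ ≠ 0)
    (T₁ : ℝ≥0 → Lp ℝ 2 m₁ →L[ℝ] Lp ℝ 2 m₁) (T₂ : ℝ≥0 → Lp ℝ 2 m₂ →L[ℝ] Lp ℝ 2 m₂)
    (hT₁ : IsMarkovianSemigroup T₁) (hT₂ : IsMarkovianSemigroup T₂)
    (hirr₁ : IsIrreducibleSemigroup T₁) (hirr₂ : IsIrreducibleSemigroup T₂)
    (U : Lp ℝ 2 m₁ ≃ₗ[ℝ] Lp ℝ 2 m₂) (hU : IsOrderIsomorphism U) (hint : Intertwines U T₁ T₂) :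
    -- `U` is continuous: it is given by a bounded operator `V`, whose norm is `‖U‖`
    ∃ V : Lp ℝ 2 m₁ →L[ℝ] Lp ℝ 2 m₂, (∀ f, V f = U f) ∧ 0 < ‖V‖ ∧
      -- `U / ‖U‖` is unitary
      (∃ W : Lp ℝ 2 m₁ ≃ₗᵢ[ℝ] Lp ℝ 2 m₂, ∀ f, W f = (1 / ‖V‖) • U f) ∧
      -- `U` has a scaling and a transformation, and `τ_# (h² m₂) = ‖U‖² m₁`
      (∃ (h : X₂ → ℝ) (τ : X₂ → X₁), IsScalingTransformation U h τ) ∧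
      (∀ (h : X₂ → ℝ) (τ : X₂ → X₁), IsScalingTransformation U h τ →
        (m₂.withDensity fun y => ENNReal.ofReal (h y ^ 2)).map τ
          = ENNReal.ofReal (‖V‖ ^ 2) • m₁) ∧
      -- `U D(Q₁) = D(Q₂)`, and `Q₂(U f, U g) = ‖U‖² Q₁(f, g)` on `D(Q₁)`
      U '' formDomain T₁ = formDomain T₂ ∧
      (∀ f ∈ formDomain T₁, ∀ g ∈ formDomain T₁,
        ∃ q : ℝ, HasFormValue T₁ f g q ∧ HasFormValue T₂ (U f) (U g) (‖V‖ ^ 2 * q)) := by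
  have hne₁ : Nonempty X₁ := by
    by_contra h
    rw [not_nonempty_iff] at h
    exact hm₁ (Measure.eq_zero_of_isEmpty m₁)
  have hnt : Nontrivial (Lp ℝ 2 m₁) := by
    obtain ⟨w, -, hw0, hw⟩ := exists_pos_memLp_two m₁
    refine nontrivial_of_ne (hw.toLp w) 0 fun h => hm₁ ?_
    rw [← ae_eq_bot, ← eventually_false_iff_eq_bot]
    filter_upwards [hw.coeFn_toLp, Lp.eq_zero_iff_ae_eq_zero.1 h] with x h1 h2
    rw [h1] at h2
    exact (hw0 x).ne' h2
  obtain ⟨f₀, hf₀⟩ := exists_ne (0 : Lp ℝ 2 m₁)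
  have hUf₀ : U f₀ ≠ 0 := by simpa using hf₀
  have hne₂ : Nonempty X₂ := by
    by_contra h
    rw [not_nonempty_iff] at h
    exact hUf₀ (Lp.ext (Eventually.of_forall fun y => h.elim y))
  obtain ⟨V, hV⟩ := hU.exists_continuousLinearMap
  obtain ⟨c, hc⟩ := exists_inner_map_map_eq hU hT₁ hT₂ hirr₁ hint
  have hsq : ∀ f, ‖U f‖ ^ 2 = c * ‖f‖ ^ 2 := fun f => by
    simpa only [real_inner_self_eq_norm_sq] using hc f f
  have hc0 : 0 < c := by
    have h1 : 0 < c * ‖f₀‖ ^ 2 := by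
      rw [← hsq]
      exact pow_pos (norm_pos_iff.2 hUf₀) 2
    exact pos_of_mul_pos_left h1 (sq_nonneg _)
  have hnorm : ∀ f, ‖U f‖ = √c * ‖f‖ := fun f => by
    rw [← Real.sqrt_sq (norm_nonneg (U f)), hsq, Real.sqrt_mul hc0.le, Real.sqrt_sq (norm_nonneg f)]
  have hVn : ‖V‖ = √c := V.homothety_norm fun f => by rw [hV, hnorm]
  have hVsq : ‖V‖ ^ 2 = c := by rw [hVn, Real.sq_sqrt hc0.le]
  have hVpos : 0 < ‖V‖ := hVn ▸ Real.sqrt_pos.2 hc0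
  refine ⟨V, hV, hVpos, ?_, hU.exists_isScalingTransformation, fun h τ hs => ?_, ?_, ?_⟩
  · refine ⟨⟨U.trans (LinearEquiv.smulOfNeZero ℝ _ (1 / ‖V‖) (by positivity)), fun f => ?_⟩,
      fun f => rfl⟩
    change ‖(1 / ‖V‖) • U f‖ = ‖f‖
    rw [norm_smul, hnorm, ← hVn, Real.norm_of_nonneg (by positivity)]
    field_simp
  · rw [hVsq]
    exact hs.map_withDensity_eq hsq
  · refine Set.Subset.antisymm ?_ fun g hg => ?_
    · rintro _ ⟨f, ⟨q, hq⟩, rfl⟩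
      exact ⟨_, hint.hasFormValue_map hc hq⟩
    · obtain ⟨q, hq⟩ := hg
      refine ⟨U.symm g, ⟨c⁻¹ * q, ?_⟩, U.apply_symm_apply g⟩
      have hint' : Intertwines U.symm T₂ T₁ := fun t f => by
        rw [U.symm_apply_eq, hint, U.apply_symm_apply]
      refine hint'.hasFormValue_map (fun f g => ?_) hq
      rw [← U.apply_symm_apply f, ← U.apply_symm_apply g, hc]
      simp [hc0.ne']
  · intro f hf g hg
    obtain ⟨q, hq⟩ := hT₁.exists_hasFormValue hf hg
    exact ⟨q, hq, hVsq.symm ▸ hint.hasFormValue_map hc hq⟩
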